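/- Equip $[0,1]^{\mathbb Z}$ with the product topology, let $\sigma((x_i)_{i})=(x_{i+1})_{i}$ be the shift, and let $\mathcal S\subset[0,1]^{\mathbb Z}$ be a subshift, i.e. a closed set with $\sigma(\mathcal S)=\mathcal S$. Let $\mathcal P_\sigma(\mathcal S)$ be the set of $\sigma$-invariant Borel probability measures on $\mathcal S$, and write $x|_0^{n-1}=(x_0,\dots,x_{n-1})$. For $v\in\mathbb R^n$ put $\|v\|_p=\big(\frac1n\sum_{i}|v_i|^p\big)^{1/p}$ if $1\le p<\infty$, and $\|v\|_\infty=\max_i|v_i|$. Let $0<\alpha\le 1$ and $p\in[1,\infty]$. For $L>0$ and an integer $n\ge1$ let $r_L(n)\in[0,\infty]$ be the infimum of $k/n$ over all integers $k\ge 1$ for which there are a Borel map $f:[0,1]^n\to[0,1]^k$ and a map $g:[0,1]^k\to[0,1]^n$ satisfying $\|g(u)-g(v)\|_p\le L\|u-v\|_p^{\alpha}$ for all $u,v\in[0,1]^k$, such that $$\mu\big(\{x\in\mathcal S : g(f(x|_0^{n-1}))\ne x|_0^{n-1}\}\big)=0\quad\text{for all }\mu\in\mathcal P_\sigma(\mathcal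 S)$$ (with $\inf\emptyset=\infty$). Let $r_{\mathcal B-\mathcal H^p_{L,\alpha}}(\mathcal S,0)=\limsup_{n\to\infty} r_L(n)$. Then $$\inf_{L>0}\ r_{\mathcal B-\mathcal H^p_{L,\alpha}}(\mathcal S,0)\le\alpha .$$ -/

import Mathlib

open scoped ENNReal NNReal
open MeasureTheory

namespace AnalogCompression

/-- The unit cube `[0,1]^n`. -/
abbrev Cube (n : ℕ) : Type := Fin n → unitInterval

/-- The space `[0,1]^ℤ` of two-sided sequences; its topology and its `σ`-algebra are the product
ones, and the latter is the Borel `σ`-algebra. -/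
abbrev Signal : Type := ℤ → unitInterval

/-- The shift `(σ x)_i = x_{i+1}`. -/
def shift (x : Signal) : Signal := fun i => x (i + 1)

/-- A subshift of `[0,1]^ℤ`: a closed set `S` with `σ(S) = S`. -/
structure IsSubshift (S : Set Signal) : Prop where
  isClosed : IsClosed S
  shift_image : shift '' S = S

/-- The initial block `(x_0, …, x_{n-1})`. -/
def block (n : ℕ) (x : Signal) : Cube n := fun i => x ((i : ℕ) : ℤ)

/-- The shift-invariant Borel probability measures on `S`, seen as measures on `[0,1]^ℤ` that are
carried by `S`, that is, the laws of stationary processes with trajectories almost surely in `S`. -/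
def invariantMeasures (S : Set Signal) : Set (Measure Signal) :=
  {μ | IsProbabilityMeasure μ ∧ MeasurePreserving shift μ μ ∧ μ Sᶜ = 0}

/-- The normalized `ℓ^p` norm on `ℝ^n`: `((1/n) ∑ |v_i|^p)^(1/p)` for `p < ∞`, and the maximum norm
for `p = ∞` (which is Mathlib's norm on `Fin n → ℝ`). -/
noncomputable def normalizedLpNorm (p : ℝ≥0∞) {n : ℕ} (v : Fin n → ℝ) : ℝ :=
  if p = ∞ then ‖v‖
  else ((1 / (n : ℝ)) * ∑ i, |v i| ^ p.toReal) ^ (1 / p.toReal)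

/-- The distance `‖x - y‖_p` of two points of the cube. -/
noncomputable def lpDist (p : ℝ≥0∞) {n : ℕ} (x y : Cube n) : ℝ :=
  normalizedLpNorm p (fun i => (x i : ℝ) - (y i : ℝ))

/-- A regularity class: a class of functions between unit cubes, given by its members
`[0,1]^n → [0,1]^k` for all `n` and `k`. -/
abbrev RegularityClass : Type := ∀ n k : ℕ, Set (Cube n → Cube k)

/-- The Borel maps. -/
def borelClass : RegularityClass := fun _ _ => {f | Measurable f}

/-- The `(L, α)`-Hölder maps with respect to the normalized `ℓ^p` norms. -/
def holderClass (p : ℝ≥0∞) (L α : ℝ) : RegularityClass := fun _ _ =>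
  {f | ∀ x y, lpDist p (f x) (f y) ≤ L * lpDist p x y ^ α}

/-- The uniform almost lossless compression rate of `S` at block length `n` with error probability
`ε`: the infimum of `k / n` over the `k ≥ 1` for which there are a compressor `f` in `C` and a
decompressor `g` in `D` with error probability at most `ε` under every shift-invariant probability
measure on `S`. It is `∞` if there is no such `k`. -/
noncomputable def uniformRateAt (C D : RegularityClass) (S : Set Signal) (ε : ℝ≥0) (n : ℕ) :
    ℝ≥0∞ :=
  ⨅ (k : ℕ) (_ : 1 ≤ k ∧ ∃ f ∈ C n k, ∃ g ∈ D k n, ∀ μ ∈ invariantMeasures S,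
      μ {x | x ∈ S ∧ g (f (block n x)) ≠ block n x} ≤ (ε : ℝ≥0∞)),
    (k : ℝ≥0∞) / (n : ℝ≥0∞)

/-- The uniform almost lossless compression rate: the upper limit over the block length. -/
noncomputable def uniformRate (C D : RegularityClass) (S : Set Signal) (ε : ℝ≥0) : ℝ≥0∞ :=
  Filter.limsup (fun n : ℕ => uniformRateAt C D S ε n) Filter.atTop

end AnalogCompression

namespace AnalogCompression

/-! Compression to rate near `α` is possible for all points at once, so neither the subshift nor its
measures matter. If `α * b < a`, the cube of dimension `b` embeds by a Borel map into a Cantor-like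
set in the cube of dimension `a`, with `α`-Hölder inverse (`exists_measurable_expanding`): base-`M`
digit vectors are recoded injectively into vectors of `a` digits below `N`, which are read in base
`2 * N`. The unused digits create gaps, so close codes have long common prefixes. McShane's
extension makes the inverse a decoder on the whole cube (`exists_holder_leftInverse`). With `a` and
`b` fixed and `a / b` close to `α`, coding consecutive blocks independently handles every `n` with
one Hölder constant (`blockDecode_mem_holderClass`). -/

/-! ### Gaps between expansions with small digits, and the recoding map. -/

/-- Doubled digits are still admissible in base `2 * N`, and their expansion is at most 1. -/
theorem ofDigits_le_half {N : ℕ} {d : ℕ → Fin (2 * N)} (hd : ∀ i, (d i : ℕ) < N) :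
    Real.ofDigits d ≤ 1 / 2 := by
  let e : ℕ → Fin (2 * N) := fun i => ⟨2 * (d i : ℕ), by have := hd i; omega⟩
  have h : Real.ofDigits e = 2 * Real.ofDigits d := by
    simp only [Real.ofDigits]
    rw [← tsum_mul_left]
    congr 1
    ext i
    simp only [Real.ofDigitsTerm, e]
    push_cast
    ring
  have := Real.ofDigits_le_one e
  linarith

/-- At place `m` the larger expansion gains at least one unit; the tail of `d` recovers at most half
of it. -/
theorem ofDigits_add_le_of_lt {N : ℕ} {d e : ℕ → Fin (2 * N)} (hd : ∀ i, (d i : ℕ) < N)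
    {m : ℕ} (heq : ∀ i < m, d i = e i) (hlt : (d m : ℕ) < e m) :
    Real.ofDigits d + (((2 * N : ℕ) : ℝ) ^ (m + 1))⁻¹ / 2 ≤ Real.ofDigits e := by
  have hsum : ∑ i ∈ Finset.range m, Real.ofDigitsTerm d i =
      ∑ i ∈ Finset.range m, Real.ofDigitsTerm e i :=
    Finset.sum_congr rfl fun i hi => by simp [Real.ofDigitsTerm, heq i (Finset.mem_range.mp hi)]
  rw [Real.ofDigits_eq_sum_add_ofDigits d (m + 1), Real.ofDigits_eq_sum_add_ofDigits e (m + 1),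
    Finset.sum_range_succ, Finset.sum_range_succ, hsum]
  simp only [Real.ofDigitsTerm]
  have h1 : Real.ofDigits (fun i => d (i + (m + 1))) ≤ 1 / 2 :=
    ofDigits_le_half fun i => hd _
  have h2 := Real.ofDigits_nonneg (fun i => e (i + (m + 1)))
  have h3 : ((d m : ℕ) : ℝ) + 1 ≤ (e m : ℕ) := by exact_mod_cast hlt
  have h4 : (0 : ℝ) ≤ (((2 * N : ℕ) : ℝ) ^ (m + 1))⁻¹ := by positivity
  nlinarith [mul_le_mul_of_nonneg_left h1 h4, mul_nonneg h4 h2, mul_le_mul_of_nonneg_left h3 h4]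

theorem le_abs_ofDigits_sub_ofDigits {N : ℕ} {d e : ℕ → Fin (2 * N)} (hd : ∀ i, (d i : ℕ) < N)
    (he : ∀ i, (e i : ℕ) < N) {m : ℕ} (heq : ∀ i < m, d i = e i) (hne : d m ≠ e m) :
    (((2 * N : ℕ) : ℝ) ^ (m + 1))⁻¹ / 2 ≤ |Real.ofDigits d - Real.ofDigits e| := by
  rcases lt_or_gt_of_ne (Fin.val_ne_of_ne hne) with h | h
  · have := ofDigits_add_le_of_lt hd heq h
    rw [abs_sub_comm]
    exact le_trans (by linarith) (le_abs_self _)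
  · have := ofDigits_add_le_of_lt he (fun i hi => (heq i hi).symm) h
    exact le_trans (by linarith) (le_abs_self _)

/-- The base-`M` digits of `x / 2`, recoded level by level along `φ` into digits smaller than `N`
and read in base `2 * N`. -/
noncomputable def recode {a b M N : ℕ} [NeZero M] (φ : (Fin b → Fin M) → Fin a → Fin N)
    (x : Cube b) : Cube a := fun i =>
  ⟨Real.ofDigits (fun m => Fin.castLE (Nat.le_mul_of_pos_left N two_pos)
    (φ (fun j => Real.digits ((x j : ℝ) / 2) M m) i)),
    Real.ofDigits_nonneg _, Real.ofDigits_le_one _⟩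

theorem measurable_recode {a b M N : ℕ} [NeZero M] (φ : (Fin b → Fin M) → Fin a → Fin N) :
    Measurable (recode φ) := by
  refine measurable_pi_lambda _ fun i => Measurable.subtype_mk ?_
  refine (Real.continuous_ofDigits (b := 2 * N)).measurable.comp (measurable_pi_lambda _ fun m => ?_)
  refine (measurable_of_finite (fun w : Fin b → Fin M =>
    Fin.castLE (Nat.le_mul_of_pos_left N two_pos) (φ w i))).comp (measurable_pi_lambda _ fun j => ?_)
  refine (measurable_of_countable (fun t : ℕ => Fin.ofNat M t)).comp (Nat.measurable_floor.comp ?_)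
  fun_prop

/-- Let `m` be the first level where the digits of `x` and `y` differ. Then `x` and `y` are within
`2 * M ^ (-m)`, while injectivity of `φ` yields a coordinate whose codes first differ at level `m`,
hence a gap of order `(2 * N) ^ (-(m + 1))`. The hypothesis `hKM` compares the two. -/
theorem dist_le_dist_recode {a b M N : ℕ} [NeZero M] (hM : 1 < M)
    {φ : (Fin b → Fin M) → Fin a → Fin N} (hφ : Function.Injective φ) {α : ℝ} (hα : 0 < α)
    (hKM : ((2 * N : ℕ) : ℝ) ^ α ≤ M) (x y : Cube b) :
    dist x y ≤ (2 * (2 * ((2 * N : ℕ) : ℝ)) ^ α) * dist (recode φ x) (recode φ y) ^ α := by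
  let D : Cube b → ℕ → Fin b → Fin M := fun x m j => Real.digits ((x j : ℝ) / 2) M m
  -- Halving moves the endpoint 1 into `[0, 1)`, where digits recover the number.
  have hD : ∀ x : Cube b, ∀ j, Real.ofDigits (fun m => D x m j) = (x j : ℝ) / 2 := fun x j =>
    Real.ofDigits_digits hM ⟨by linarith [(x j).2.1], by linarith [(x j).2.2]⟩
  by_cases hxy : ∀ m, D x m = D y m
  · have : x = y := by
      ext j
      have h1 := hD x j
      rw [show (fun m => D x m j) = fun m => D y m j from funext fun m => by rw [hxy m], hD y j] at h1
      linarith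
    rw [this, dist_self]
    positivity
  · push Not at hxy
    classical
    let m := Nat.find hxy
    have hm : D x m ≠ D y m := Nat.find_spec hxy
    have hlt : ∀ i < m, D x i = D y i := fun i hi => not_not.mp (Nat.find_min hxy hi)
    obtain ⟨i, hi⟩ := Function.ne_iff.mp (hφ.ne hm)
    have hN : 0 < N := Fin.pos (φ (D x m) i)
    set K : ℝ := ((2 * N : ℕ) : ℝ) with hK
    have hK0 : 0 < K := by rw [hK]; exact_mod_cast (by omega : 0 < 2 * N)
    have hgap : (K ^ (m + 1))⁻¹ / 2 ≤ dist (recode φ x) (recode φ y) := by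
      refine le_trans ?_ (dist_le_pi_dist _ _ i)
      refine le_abs_ofDigits_sub_ofDigits (fun l => ?_) (fun l => ?_) (fun l hl => ?_) ?_
      · exact (φ (D x l) i).2
      · exact (φ (D y l) i).2
      · exact congrArg (fun w => Fin.castLE (Nat.le_mul_of_pos_left N two_pos) (φ w i)) (hlt l hl)
      · exact fun h => hi (Fin.castLE_injective _ h)
    have hnear : dist x y ≤ 2 * ((M : ℝ) ^ m)⁻¹ := by
      refine (dist_pi_le_iff (by positivity)).mpr fun j => ?_
      have h := Real.abs_ofDigits_sub_ofDigits_le (x := fun m => D x m j) (y := fun m => D y m j)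
        (n := m) (fun i hi => by rw [hlt i hi])
      rw [hD, hD, ← sub_div, abs_div, abs_two] at h
      change |(x j : ℝ) - y j| ≤ _
      linarith
    refine hnear.trans ?_
    rw [mul_assoc]
    refine mul_le_mul_of_nonneg_left ?_ zero_le_two
    calc ((M : ℝ) ^ m)⁻¹ ≤ ((K ^ α) ^ m)⁻¹ := by gcongr
      _ = (2 * K) ^ α * ((K ^ (m + 1))⁻¹ / 2) ^ α := by
        rw [← Real.mul_rpow (by positivity) (by positivity),
          show 2 * K * ((K ^ (m + 1))⁻¹ / 2) = (K ^ m)⁻¹ by rw [pow_succ]; field_simp,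
          Real.inv_rpow (by positivity), ← Real.rpow_natCast, ← Real.rpow_natCast,
          ← Real.rpow_mul hK0.le, ← Real.rpow_mul hK0.le, mul_comm]
      _ ≤ _ := by gcongr

theorem exists_measurable_expanding {α : ℝ} (hα : 0 < α) {a b : ℕ} (hab : α * b < a) :
    ∃ C : ℝ, 0 < C ∧ ∃ f : Cube b → Cube a, Measurable f ∧
      ∀ x y, dist x y ≤ C * dist (f x) (f y) ^ α := by
  -- This `s` gives `α * (b * s + 1) ≤ a * s`, that is `(2 * N) ^ α ≤ M` for `M = 2 ^ (a * s)` and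
  -- `N = 2 ^ (b * s)`; the `+ 1` pays for the doubled base.
  obtain ⟨s, hs⟩ := exists_nat_ge (α / (a - α * b))
  have hpos : (0 : ℝ) < a - α * b := by linarith
  have ha : 0 < a := by
    have : (0 : ℝ) < a := lt_of_le_of_lt (by positivity) hab
    exact_mod_cast this
  have hs0 : 0 < s := by
    have : (0 : ℝ) < s := lt_of_lt_of_le (by positivity) hs
    exact_mod_cast this
  rw [div_le_iff₀ hpos] at hs
  have hM : 1 < 2 ^ (a * s) := Nat.one_lt_two_pow (by positivity)
  -- Both sides have `2 ^ (a * b * s)` elements.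
  obtain ⟨φ⟩ : Nonempty ((Fin b → Fin (2 ^ (a * s))) ↪ (Fin a → Fin (2 ^ (b * s)))) := by
    refine Function.Embedding.nonempty_of_card_le (le_of_eq ?_)
    simp only [Fintype.card_fun, Fintype.card_fin, ← pow_mul]
    congr 1
    ring
  refine ⟨2 * (2 * ((2 * 2 ^ (b * s) : ℕ) : ℝ)) ^ α, by positivity, recode φ,
    measurable_recode _, dist_le_dist_recode hM φ.injective hα ?_⟩
  rw [← pow_succ']
  push_cast
  rw [← Real.rpow_natCast, ← Real.rpow_natCast, ← Real.rpow_mul two_pos.le]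
  refine Real.rpow_le_rpow_of_exponent_le one_le_two ?_
  push_cast
  linarith

/-! ### Hölder decoder on the whole cube. -/

/-- McShane's extension of the inverse of an expanding map. -/
theorem exists_holder_leftInverse {α : ℝ} (hα₀ : 0 < α) (hα₁ : α ≤ 1) {a b : ℕ} {C : ℝ}
    (hC : 0 < C) {f : Cube b → Cube a} (hf : ∀ x y, dist x y ≤ C * dist (f x) (f y) ^ α) :
    ∃ g : Cube a → Cube b, (∀ u v, dist (g u) (g v) ≤ C * dist u v ^ α) ∧
      Function.LeftInverse g f := by
  let F : Fin b → Cube a → Cube b → ℝ := fun i u x => (x i : ℝ) + C * dist u (f x) ^ α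
  have hbdd : ∀ i u, BddBelow (Set.range (F i u)) := fun i u =>
    ⟨0, by rintro _ ⟨x, rfl⟩; have := (x i).2.1; positivity⟩
  have hle : ∀ i u v, (⨅ x, F i u x) ≤ (⨅ x, F i v x) + C * dist u v ^ α := by
    intro i u v
    rw [← sub_le_iff_le_add]
    refine le_ciInf fun x => ?_
    rw [sub_le_iff_le_add]
    refine (ciInf_le (hbdd i u) x).trans ?_
    -- Since `α ≤ 1`, `dist ^ α` still satisfies the triangle inequality.
    have h1 : dist u (f x) ^ α ≤ dist v (f x) ^ α + dist u v ^ α := by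
      refine (Real.rpow_le_rpow dist_nonneg (dist_triangle u v (f x)) hα₀.le).trans ?_
      rw [add_comm (dist v (f x) ^ α)]
      exact Real.rpow_add_le_add_rpow dist_nonneg dist_nonneg hα₀.le hα₁
    have := mul_le_mul_of_nonneg_left h1 hC.le
    simp only [F]
    linarith
  refine ⟨fun u i => Set.projIcc 0 1 zero_le_one (⨅ x, F i u x), fun u v => ?_, fun y => ?_⟩
  · refine (dist_pi_le_iff (by positivity)).mpr fun i => ?_
    refine ((LipschitzWith.projIcc zero_le_one).dist_le_mul _ _).trans ?_
    rw [NNReal.coe_one, one_mul, Real.dist_eq, abs_sub_le_iff]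
    constructor
    · linarith [hle i u v]
    · have := hle i v u
      rw [dist_comm v u] at this
      linarith
  · funext i
    have : (⨅ x, F i (f y) x) = y i := by
      refine le_antisymm ((ciInf_le (hbdd i _) y).trans ?_) (le_ciInf fun x => ?_)
      · simp [F, Real.zero_rpow hα₀.ne']
      · have h1 := (dist_le_pi_dist y x i).trans (hf y x)
        have h2 : |(y i : ℝ) - x i| ≤ _ := h1
        have := le_abs_self ((y i : ℝ) - x i)
        simp only [F]
        linarith
    simp only [this]
    exact Set.projIcc_val zero_le_one (y i)

/-! ### Blockwise coding and its Hölder constant. -/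

/-- Applies `f` to each of `q` consecutive blocks of length `b`, after padding with zeros. -/
noncomputable def blockEncode {a b : ℕ} (f : Cube b → Cube a) (n q : ℕ) (x : Cube n) :
    Cube (q * a) := fun m =>
  f (fun l => if h : (finProdFinEquiv ((finProdFinEquiv.symm m).1, l) : Fin (q * b)).val < n
    then x ⟨_, h⟩ else 0) (finProdFinEquiv.symm m).2

/-- Applies `g` to each of `q` consecutive blocks of length `a` and keeps the first `n` entries. -/
def blockDecode {a b : ℕ} (g : Cube a → Cube b) {n q : ℕ} (hn : n ≤ q * b) (u : Cube (q * a)) :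
    Cube n := fun i =>
  g (fun l => u (finProdFinEquiv ((finProdFinEquiv.symm (Fin.castLE hn i)).1, l)))
    (finProdFinEquiv.symm (Fin.castLE hn i)).2

theorem measurable_blockEncode {a b : ℕ} {f : Cube b → Cube a} (hf : Measurable f) (n q : ℕ) :
    Measurable (blockEncode f n q) := by
  refine measurable_pi_lambda _ fun m => ?_
  refine (measurable_pi_apply _).comp (hf.comp (measurable_pi_lambda _ fun l => ?_))
  split_ifs
  · exact measurable_pi_apply _
  · exact measurable_const

theorem blockDecode_blockEncode {a b : ℕ} {f : Cube b → Cube a} {g : Cube a → Cube b}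
    (hfg : Function.LeftInverse g f) {n q : ℕ} (hn : n ≤ q * b) (x : Cube n) :
    blockDecode g hn (blockEncode f n q x) = x := by
  funext i
  simp only [blockDecode, blockEncode, Equiv.symm_apply_apply]
  refine (congrFun (hfg fun l => if h : (finProdFinEquiv
    ((finProdFinEquiv.symm (Fin.castLE hn i)).1, l) : Fin (q * b)).val < n
    then x ⟨_, h⟩ else 0) _).trans ?_
  have hi : (i : ℕ) % b + b * (i / b) = i := Nat.mod_add_div _ _
  simp [hi]

/-- Jensen's inequality for the concave function `t ^ α`, with uniform weights. -/
theorem sum_rpow_le_card_mul {ι : Type*} [Fintype ι] [Nonempty ι] {E : ι → ℝ} (hE : ∀ j, 0 ≤ E j)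
    {α : ℝ} (hα₀ : 0 ≤ α) (hα₁ : α ≤ 1) :
    ∑ j, E j ^ α ≤ Fintype.card ι * ((∑ j, E j) / Fintype.card ι) ^ α := by
  have hc : (0 : ℝ) < Fintype.card ι := by exact_mod_cast Fintype.card_pos
  have h := (Real.concaveOn_rpow hα₀ hα₁).le_map_sum (t := Finset.univ)
    (w := fun _ : ι => (Fintype.card ι : ℝ)⁻¹) (p := E) (fun _ _ => by positivity)
    (by simp [hc.ne']) (fun j _ => hE j)
  simp only [smul_eq_mul, ← Finset.mul_sum] at h
  rw [inv_mul_le_iff₀ hc] at h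
  rwa [div_eq_inv_mul]

theorem dist_rpow_le_sum {a : ℕ} {P : ℝ} (hP : 0 < P) (u v : Cube a) :
    dist u v ^ P ≤ ∑ l, |(u l : ℝ) - v l| ^ P := by
  have h0 : 0 ≤ ∑ l, |(u l : ℝ) - v l| ^ P := Finset.sum_nonneg fun _ _ => by positivity
  rw [← Real.le_rpow_inv_iff_of_pos dist_nonneg h0 hP]
  refine (dist_pi_le_iff (by positivity)).mpr fun l => ?_
  rw [Real.le_rpow_inv_iff_of_pos dist_nonneg h0 hP]
  exact Finset.single_le_sum (f := fun l => |(u l : ℝ) - v l| ^ P)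
    (fun _ _ => by positivity) (Finset.mem_univ l)

theorem abs_blockDecode_sub_le {α C : ℝ} {a b : ℕ} {g : Cube a → Cube b}
    (hg : ∀ u v, dist (g u) (g v) ≤ C * dist u v ^ α) {n q : ℕ} (hn : n ≤ q * b)
    (u v : Cube (q * a)) (i : Fin n) :
    |(blockDecode g hn u i : ℝ) - blockDecode g hn v i| ≤
      C * dist (fun l => u (finProdFinEquiv ((finProdFinEquiv.symm (Fin.castLE hn i)).1, l)))
        (fun l => v (finProdFinEquiv ((finProdFinEquiv.symm (Fin.castLE hn i)).1, l))) ^ α :=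
  (dist_le_pi_dist _ _ _).trans (hg _ _)

/-- Each entry decoded from block `j` contributes at most `C ^ P * E j ^ α`, and each block has at
most `b` kept entries; Jensen then averages over the `q` blocks. -/
theorem sum_blockDecode_rpow_le {α C : ℝ} (hα₀ : 0 < α) (hα₁ : α ≤ 1) (hC : 0 < C) {a b : ℕ}
    {g : Cube a → Cube b} (hg : ∀ u v, dist (g u) (g v) ≤ C * dist u v ^ α) {n q : ℕ}
    (hq : 0 < q) (hn : n ≤ q * b) {P : ℝ} (hP : 0 < P) (u v : Cube (q * a)) :
    ∑ i, |(blockDecode g hn u i : ℝ) - blockDecode g hn v i| ^ P ≤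
      (q * b : ℕ) * (C ^ P * ((∑ m, |(u m : ℝ) - v m| ^ P) / q) ^ α) := by
  have : Nonempty (Fin q) := ⟨⟨0, hq⟩⟩
  let E : Fin q → ℝ := fun j =>
    ∑ l : Fin a, |(u (finProdFinEquiv (j, l)) : ℝ) - v (finProdFinEquiv (j, l))| ^ P
  have hE : ∀ j, 0 ≤ E j := fun j => Finset.sum_nonneg fun _ _ => by positivity
  have hsum : ∑ j, E j = ∑ m, |(u m : ℝ) - v m| ^ P := by
    rw [← Equiv.sum_comp finProdFinEquiv, Fintype.sum_prod_type]
  have hterm : ∀ i, |(blockDecode g hn u i : ℝ) - blockDecode g hn v i| ^ P ≤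
      C ^ P * E (finProdFinEquiv.symm (Fin.castLE hn i)).1 ^ α := by
    intro i
    refine (Real.rpow_le_rpow (abs_nonneg _) (abs_blockDecode_sub_le hg hn u v i) hP.le).trans ?_
    rw [Real.mul_rpow hC.le (by positivity), ← Real.rpow_mul dist_nonneg, mul_comm α,
      Real.rpow_mul dist_nonneg]
    gcongr
    exact dist_rpow_le_sum hP _ _
  have hinj : Function.Injective fun i : Fin n =>
      (finProdFinEquiv.symm (Fin.castLE hn i) : Fin q × Fin b) :=
    finProdFinEquiv.symm.injective.comp (Fin.castLE_injective hn)
  calc _ ≤ ∑ i, C ^ P * E (finProdFinEquiv.symm (Fin.castLE hn i)).1 ^ α :=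
        Finset.sum_le_sum fun i _ => hterm i
    _ = ∑ t ∈ Finset.univ.map ⟨_, hinj⟩, C ^ P * E t.1 ^ α := by rw [Finset.sum_map]; rfl
    _ ≤ ∑ t : Fin q × Fin b, C ^ P * E t.1 ^ α :=
        Finset.sum_le_sum_of_subset_of_nonneg (Finset.subset_univ _) fun t _ _ => by
          have := hE t.1
          positivity
    _ = b * (C ^ P * ∑ j, E j ^ α) := by
        rw [Fintype.sum_prod_type]
        simp [Finset.mul_sum]
    _ ≤ b * (C ^ P * (q * ((∑ j, E j) / q) ^ α)) := by
        have := sum_rpow_le_card_mul hE hα₀.le hα₁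
        rw [Fintype.card_fin] at this
        gcongr
    _ = _ := by
        rw [hsum]
        push_cast
        ring

/-- The constant depends on neither `n` nor `q`: the factor `1 + b` bounds `q * b / n`, and `a`
accounts for normalizing by `q * a` entries instead of `q` blocks. -/
theorem blockDecode_mem_holderClass {α C : ℝ} (hα₀ : 0 < α) (hα₁ : α ≤ 1) (hC : 0 < C) {a b : ℕ}
    (ha : 0 < a) {g : Cube a → Cube b} (hg : ∀ u v, dist (g u) (g v) ≤ C * dist u v ^ α)
    {n q : ℕ} (hn₀ : 0 < n) (hn : n ≤ q * b) (hq : q * b ≤ (1 + b) * n) {p : ℝ≥0∞} (hp : 1 ≤ p) :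
    blockDecode g hn ∈ holderClass p ((1 + b) * a * C) α (q * a) n := by
  have ha1 : (1 : ℝ) ≤ a := by exact_mod_cast ha
  have hb1 : (1 : ℝ) ≤ 1 + b := by linarith [(Nat.cast_nonneg b : (0 : ℝ) ≤ b)]
  have hq0 : 0 < q := Nat.pos_of_ne_zero fun h => by simp [h] at hn; omega
  have hqR : (0 : ℝ) < q := by exact_mod_cast hq0
  have hnR : (0 : ℝ) < n := by exact_mod_cast hn₀
  intro u v
  unfold lpDist normalizedLpNorm
  split_ifs with hpt
  · refine (pi_norm_le_iff_of_nonneg (by positivity)).mpr fun i => ?_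
    refine (abs_blockDecode_sub_le hg hn u v i).trans ?_
    have hCL : C ≤ (1 + b) * a * C := le_mul_of_one_le_left hC.le (by nlinarith)
    gcongr
    refine (dist_pi_le_iff (norm_nonneg _)).mpr fun l => ?_
    exact norm_le_pi_norm (fun m => (u m : ℝ) - v m) _
  · set P := p.toReal
    have hP : 1 ≤ P := by
      have := ENNReal.toReal_mono hpt hp
      simpa using this
    have hP0 : 0 < P := by linarith
    set T := 1 / ((q * a : ℕ) : ℝ) * ∑ m, |(u m : ℝ) - v m| ^ P with hT
    have hT0 : 0 ≤ T := mul_nonneg (by positivity) (Finset.sum_nonneg fun _ _ => by positivity)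
    have hsum : (∑ m, |(u m : ℝ) - v m| ^ P) / q = a * T := by
      rw [hT]
      push_cast
      field_simp
    clear_value T
    have hmain := sum_blockDecode_rpow_le hα₀ hα₁ hC hg hq0 hn hP0 u v
    rw [hsum] at hmain
    have hqb : ((q * b : ℕ) : ℝ) ≤ (1 + b) * n := by exact_mod_cast hq
    -- Raising both factors to the power `P ≥ 1` makes the constant independent of `p` after the
    -- `P`-th root.
    have h1 : (1 + b : ℝ) ≤ (1 + b) ^ P := Real.self_le_rpow_of_one_le hb1 hP
    have h2 : (a : ℝ) ^ α ≤ (a : ℝ) ^ P := Real.rpow_le_rpow_of_exponent_le ha1 (hα₁.trans hP)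
    have key : 1 / (n : ℝ) * ∑ i, |(blockDecode g hn u i : ℝ) - blockDecode g hn v i| ^ P ≤
        ((1 + b) * a * C * (T ^ (1 / P)) ^ α) ^ P := by
      calc _ ≤ 1 / (n : ℝ) * ((1 + b) * n * (C ^ P * (a * T) ^ α)) := by
            gcongr
            exact hmain.trans (by gcongr)
        _ = (1 + b) * a ^ α * C ^ P * T ^ α := by
            rw [Real.mul_rpow (by positivity) hT0]
            field_simp
        _ ≤ (1 + b) ^ P * a ^ P * C ^ P * T ^ α := by gcongr
        _ = _ := by
            rw [Real.mul_rpow (by positivity) (by positivity), Real.mul_rpow (by positivity) hC.le,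
              Real.mul_rpow (by positivity) (by positivity), ← Real.rpow_mul hT0,
              ← Real.rpow_mul hT0]
            congr 2
            field_simp
    refine (Real.rpow_le_rpow (mul_nonneg (by positivity)
      (Finset.sum_nonneg fun _ _ => by positivity)) key (by positivity)).trans (le_of_eq ?_)
    rw [one_div, Real.rpow_rpow_inv (by positivity) hP0.ne']

/-! ### The rate of the block code. -/

theorem exists_uniformRate_le (S : Set Signal) {α : ℝ} (hα₀ : 0 < α) (hα₁ : α ≤ 1) {p : ℝ≥0∞}
    (hp : 1 ≤ p) {β : ℝ} (hβ : α < β) :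
    ∃ L : ℝ, 0 < L ∧ uniformRate borelClass (holderClass p L α) S 0 ≤ ENNReal.ofReal β := by
  obtain ⟨b, hb⟩ := exists_nat_gt (1 / (β - α))
  have hβα : 0 < β - α := by linarith
  have hbR : (0 : ℝ) < b := lt_trans (by positivity) hb
  have hb0 : 0 < b := by exact_mod_cast hbR
  rw [div_lt_iff₀ hβα] at hb
  -- The interval from `α * b` to `β * b` is longer than 1, so it contains an integer.
  obtain ⟨a, hab, haβ⟩ : ∃ a : ℕ, α * b < a ∧ (a : ℝ) < β * b := by
    refine ⟨⌊α * b⌋₊ + 1, by exact_mod_cast Nat.lt_floor_add_one _, ?_⟩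
    have := Nat.floor_le (show 0 ≤ α * b by positivity)
    push_cast
    linarith
  have ha : 0 < a := by
    have : (0 : ℝ) < a := lt_of_le_of_lt (by positivity) hab
    exact_mod_cast this
  obtain ⟨C, hC, f, hfm, hf⟩ := exists_measurable_expanding hα₀ hab
  obtain ⟨g, hg, hgf⟩ := exists_holder_leftInverse hα₀ hα₁ hC hf
  refine ⟨(1 + b) * a * C, by positivity, Filter.limsup_le_of_le (by isBoundedDefault) ?_⟩
  -- From `n₀` on, `a * (n + b) ≤ β * b * n`, so the cost of the padded last block is absorbed.
  obtain ⟨n₀, hn₀⟩ := exists_nat_ge (a * b / (β * b - a))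
  rw [div_le_iff₀ (by linarith)] at hn₀
  filter_upwards [Filter.eventually_ge_atTop n₀, Filter.eventually_ge_atTop 1] with n hn hn1
  have hle : n ≤ (n / b + 1) * b := by
    have := Nat.lt_div_mul_add (a := n) hb0
    rw [add_mul, one_mul]
    exact this.le
  have hge : (n / b + 1) * b ≤ n + b := by
    rw [add_mul, one_mul]
    exact Nat.add_le_add_right (Nat.div_mul_le_self n b) b
  have hub : (n / b + 1) * b ≤ (1 + b) * n := hge.trans (by nlinarith)
  refine (iInf₂_le ((n / b + 1) * a) ⟨Nat.mul_pos (Nat.succ_pos _) ha,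
    blockEncode f n _, measurable_blockEncode hfm n _, blockDecode g hle,
    blockDecode_mem_holderClass hα₀ hα₁ hC ha hg hn1 hle hub hp, fun μ _ => ?_⟩).trans ?_
  · refine ENNReal.div_le_of_le_mul ?_
    rw [← ENNReal.ofReal_natCast, ← ENNReal.ofReal_natCast n,
      ← ENNReal.ofReal_mul (by linarith)]
    refine ENNReal.ofReal_le_ofReal ?_
    have h1 : (((n / b + 1) * b : ℕ) : ℝ) ≤ n + b := by exact_mod_cast hge
    have h2 : (n₀ : ℝ) ≤ n := by exact_mod_cast hn
    have h3 : (a : ℝ) * b ≤ n * (β * b - a) :=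
      hn₀.trans (mul_le_mul_of_nonneg_right h2 (by linarith))
    have h4 : (a : ℝ) * (((n / b + 1) * b : ℕ) : ℝ) ≤ a * (n + b) := by gcongr
    rw [Nat.cast_mul] at h4 ⊢
    refine le_of_mul_le_mul_right ?_ hbR
    linarith
  -- Decoding is exact at every point, so the error set is empty.
  · exact (measure_mono_null (fun x hx => hx.2 (blockDecode_blockEncode hgf hle _))
      measure_empty).le.trans zero_le

end AnalogCompression

theorem proposition5p2p4 (S : Set AnalogCompression.Signal)
    (hS : AnalogCompression.IsSubshift S) (α : ℝ) (hα₀ : 0 < α) (hα₁ : α ≤ 1)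
    (p : ℝ≥0∞) (hp : 1 ≤ p) :
    (⨅ (L : ℝ) (_ : 0 < L),
      AnalogCompression.uniformRate AnalogCompression.borelClass
        (AnalogCompression.holderClass p L α) S 0) ≤ ENNReal.ofReal α := by
  refine ENNReal.le_of_forall_pos_le_add fun ε hε _ => ?_
  obtain ⟨L, hL, h⟩ := AnalogCompression.exists_uniformRate_le S hα₀ hα₁ hp
    (show α < α + ε by simpa using hε)
  refine (iInf₂_le L hL).trans (h.trans (le_of_eq ?_))
  rw [ENNReal.ofReal_add hα₀.le ε.coe_nonneg, ENNReal.ofReal_coe_nnreal]
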